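/- **Setting.** Let $\mathcal X$ be the input space (for example a subset of $\mathbb R^N$), let $\mathcal Y\subset\mathbb R$ be an output set with $|y|\le B$ for all $y\in\mathcal Y$, let $\mathbf D$ be a probability distribution on $\mathcal X\times\mathcal Y$, and let $S=((x_i,y_i))_{i=1}^m$ ($m\ge 1$) be an i.i.d. sample from $\mathbf D$. Let $\mathcal F$ be a uniformly bounded (pointwise measurable) class of functions $\mathcal X\to\mathbb R$ with Rademacher complexity $$\mathcal R_m(\mathcal F)=\mathbb E_{S}\,\mathbb E_\sigma\Big[\sup_{f\in\mathcal F}\frac1m\sum_{i=1}^m\sigma_i f(x_i)\Big],$$ with $\sigma_i$ independent and uniform on $\{-1,1\}$. Let $\mathcal G$ be a set of feature maps $\Phi=(\phi_1,\dots,\phi_D)$ on $\mathcal X$ with $\phi_i\in\mathcal F$, $\phi_i\ge 0$ and $\|\Phi(x)\|_2\le A$ for all $x\in\mathcal X$. The set $\mathcal G$ may be random (for example, one random feature map), drawn independently of $S$. For $w\in\mathbb R^D$ put $G_w(x)=\sum_{i=1}^D w_i\phi_i(x)=w^T\Phi(x)$. For a model $h$ let $E(h,x,y)=\frac12\|h(x)-y\|^2$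 and $$\Delta_{\mathbf D,S}E(h)=\mathbb E_{(x,y)\sim \mathbf D}[E(h,x,y)]-\frac1m\sum_{i=1}^m E(h,x_i,y_i).$$ **Theorem.** Let $0<\delta<1$. Suppose the features are $\vartheta$-diverse with probability $\tau$: with probability at least $\tau$ over the draw of the features, $$\tfrac12\sum_{i\ne j}(\phi_i(x)-\phi_j(x))^2\ge\vartheta^2\qquad\text{for every input }x\in\mathcal X\text{ and every }\Phi\in\mathcal G$$ (sum over ordered pairs). For $W\ge 0$ let $$b_W(\vartheta)=4DW\big(W\sqrt{DA^2-\vartheta^2}+B\big)\mathcal R_m(\mathcal F)+\tfrac12\big(W\sqrt{DA^2-\vartheta^2}+B\big)^2\sqrt{\frac{\log(2/\delta)}{2m}} .$$ 1. For every weight vector $w\in\mathbb R^D$, with probability at least $(1-\delta)\tau$ over the features and the sample, $\Delta_{\mathbf D,S}E(h)\le b_{\|w\|_\infty}(\vartheta)$ for all $h=w^T\Phi$ with $\Phi\in\mathcal G$. 2. If $\mathcal F$ contains the zero function then, for every $W\ge0$, with probability at least $(1-\delta)\tau$ over the features and the sample, $\Delta_{\mathbf D,S}E(h)\le b_W(\vartheta)$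 for all $h=w^T\Phi$ with $\|w\|_\infty\le W$ and $\Phi\in\mathcal G$, simultaneously. 3. The bound decreases as the diversity grows: for every $W>0$, $\vartheta\mapsto b_W(\vartheta)$ is strictly decreasing on $[0,\sqrt D\,A]$. -/

import Mathlib

open MeasureTheory Filter Topology

noncomputable section

namespace EBM

/-- Feature maps `Φ = (φ₁, …, φ_D)` on the input set `X`; the Euclidean norm is the one of the
values. -/
abbrev FeatureMap (X : Type*) (D : ℕ) : Type _ := X → EuclideanSpace ℝ (Fin D)

/-- The inner model `G_w(x) = ∑ i, w i * φ i x = wᵀ Φ(x)`. -/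
def innerModel {X : Type*} {D : ℕ} (w : Fin D → ℝ) (Φ : FeatureMap X D) : X → ℝ :=
  fun x => ∑ i, w i * Φ x i

/-- The squared energy `E(h, x, y) = ½ ‖h x - y‖²`. -/
def energy {X : Type*} (h : X → ℝ) (x : X) (y : ℝ) : ℝ :=
  (1 / 2) * ‖h x - y‖ ^ 2

/-- The class of all inner models with weights in `𝒲` and feature map in `𝒢`. -/
def hypothesisClass {X : Type*} {D : ℕ} (𝒲 : Set (Fin D → ℝ)) (𝒢 : Set (FeatureMap X D)) :
    Set (X → ℝ) :=
  {h | ∃ w ∈ 𝒲, ∃ Φ ∈ 𝒢, h = innerModel w Φ}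

/-- Expected energy minus the average energy over the sample `S`. -/
def generalizationGap {X : Type*} [MeasurableSpace X] (μ : Measure (X × ℝ)) {m : ℕ}
    (S : Fin m → X × ℝ) (h : X → ℝ) : ℝ :=
  ∫ z, energy h z.1 z.2 ∂μ - (1 / (m : ℝ)) * ∑ i, energy h (S i).1 (S i).2

/-- The pairwise diversity `½ ∑_{i ≠ j} (φ_i(x) - φ_j(x))²` of the feature values `v = Φ(x)`; the
sum runs over ordered pairs. -/
def diversity {D : ℕ} (v : EuclideanSpace ℝ (Fin D)) : ℝ :=
  (1 / 2) * ∑ p ∈ (Finset.univ : Finset (Fin D)).offDiag, (v p.1 - v p.2) ^ 2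

/-- A feature map is `ϑ`-diverse if its pairwise diversity is at least `ϑ²` at every input. -/
def IsDiverse {X : Type*} {D : ℕ} (ϑ : ℝ) (Φ : FeatureMap X D) : Prop :=
  ∀ x, ϑ ^ 2 ≤ diversity (Φ x)

/-- The event `s` has probability at least `p`. So that this is meaningful for every event, it
is asked that `s` contains a measurable event of probability at least `p`; for measurable `s` this
is `p ≤ P s`. -/
def ProbAtLeast {Ω : Type*} [MeasurableSpace Ω] (P : Measure Ω) (p : ℝ) (s : Set Ω) : Prop :=
  ∃ t, MeasurableSet t ∧ t ⊆ s ∧ ENNReal.ofReal p ≤ P t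

/-- Empirical Rademacher complexity of `𝓕` at the points `x`. The signs `σ i` are uniform on
`ℤˣ = {1, -1}` and independent, so the expectation over them is the average over the `2 ^ m`
sign vectors. -/
def empiricalRademacher {X : Type*} {m : ℕ} (𝓕 : Set (X → ℝ)) (x : Fin m → X) : ℝ :=
  (1 / (2 : ℝ) ^ m) *
    ∑ σ : Fin m → ℤˣ, ⨆ f : 𝓕, (1 / (m : ℝ)) * ∑ i, ((σ i : ℤ) : ℝ) * (f : X → ℝ) (x i)

/-- Rademacher complexity: expectation of the empirical one over `m` independent samples. -/
def rademacher {X : Type*} [MeasurableSpace X] (μ : Measure (X × ℝ)) (m : ℕ)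
    (𝓕 : Set (X → ℝ)) : ℝ :=
  ∫ S : Fin m → X × ℝ, empiricalRademacher 𝓕 (fun i => (S i).1) ∂(Measure.pi fun _ => μ)

/-- Pointwise measurable class of functions: it has a countable subclass of measurable functions
from which every member is obtained as a pointwise limit of a sequence. This makes suprema over
the class measurable. -/
def PointwiseMeasurable {X : Type*} [MeasurableSpace X] (𝓕 : Set (X → ℝ)) : Prop :=
  ∃ g : ℕ → X → ℝ, (∀ k, Measurable (g k) ∧ g k ∈ 𝓕) ∧
    ∀ f ∈ 𝓕, ∃ k : ℕ → ℕ, ∀ x, Tendsto (fun j => g (k j) x) atTop (𝓝 (f x))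

/-- The same for a random class of feature maps `𝒢 ω`, with joint measurability in the random
element `ω` and the input. A single random feature map, `𝒢 ω = {Φ ω}`, qualifies as soon as `Φ` is
jointly measurable. -/
def RandomPointwiseMeasurable {Ω X : Type*} [MeasurableSpace Ω] [MeasurableSpace X] {D : ℕ}
    (𝒢 : Ω → Set (FeatureMap X D)) : Prop :=
  ∃ Ψ : ℕ → Ω → FeatureMap X D,
    (∀ k, Measurable (fun q : Ω × X => Ψ k q.1 q.2) ∧ ∀ ω, Ψ k ω ∈ 𝒢 ω) ∧
    ∀ ω, ∀ Φ ∈ 𝒢 ω, ∃ k : ℕ → ℕ, ∀ x, Tendsto (fun j => Ψ (k j) ω x) atTop (𝓝 (Φ x))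

/-- The bound on the generalization gap, for weights of sup norm `W` and a feature class of
Rademacher complexity `R`. -/
def regressionBound (D m : ℕ) (A B δ W R ϑ : ℝ) : ℝ :=
  4 * D * W * (W * √(D * A ^ 2 - ϑ ^ 2) + B) * R
    + (1 / 2) * (W * √(D * A ^ 2 - ϑ ^ 2) + B) ^ 2 * √(Real.log (2 / δ) / (2 * m))

end EBM

end

noncomputable section

namespace EBM

/-! Diversity is the defect in the Cauchy–Schwarz inequality against the all-ones vector: `(∑ i, v
i) ^ 2 + diversity v = D * ‖v‖ ^ 2`. Nonnegative `ϑ`-diverse features therefore have sum at most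
`√(D * A ^ 2 - ϑ ^ 2)`, and a model with `‖w‖ ≤ W` is bounded by `M = W * √(D * A ^ 2 - ϑ ^ 2)`.
With labels bounded by `B`, the energy is then at most `(M + B) ^ 2 / 2` and `(M + B)`-Lipschitz in
the prediction. Diversity enters only through `M`.

For fixed features the rest is the classical Rademacher argument. McDiarmid's inequality
(`measure_boundedDifferences_ge_le`) concentrates the largest gap around its mean. Symmetrization
(`integral_ciSup_gap_le`) bounds the mean by twice the complexity of the losses. Contraction
(`sum_ciSup_contraction`) removes the energy at the cost of a factor `M + B`. Linear combinations
cost `D * W` for one weight vector (`rademacherAverage_linear_le`) and `2 * D * W` over a ball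
(`rademacherAverage_linear_ball_le`).

Features and sample are independent, so Fubini multiplies `1 - δ` by `τ`. Suprema are taken over
countable approximating families, hence are measurable; pointwise limits carry the bound to the
whole class. -/

/-! ### Bounded suprema and the contraction principle -/

lemma bddAbove_range_of_abs_le {ι : Type*} {u : ι → ℝ} {C : ℝ} (h : ∀ k, |u k| ≤ C) :
    BddAbove (Set.range u) :=
  ⟨C, by rintro _ ⟨k, rfl⟩; exact (le_abs_self _).trans (h k)⟩

lemma abs_ciSup_le {ι : Type*} [Nonempty ι] {u : ι → ℝ} {C : ℝ} (h : ∀ k, |u k| ≤ C) :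
    |⨆ k, u k| ≤ C := by
  refine abs_le.2 ⟨?_, ciSup_le fun k => (le_abs_self _).trans (h k)⟩
  obtain ⟨k⟩ := ‹Nonempty ι›
  exact (neg_le_of_abs_le (h k)).trans (le_ciSup (bddAbove_range_of_abs_le h) k)

lemma abs_ciSup_sub_ciSup_le {ι : Type*} [Nonempty ι] {u v : ι → ℝ} {C c : ℝ}
    (hu : ∀ k, |u k| ≤ C) (hv : ∀ k, |v k| ≤ C) (h : ∀ k, |u k - v k| ≤ c) :
    |(⨆ k, u k) - ⨆ k, v k| ≤ c := by
  have key : ∀ {u v : ι → ℝ}, (∀ k, |v k| ≤ C) → (∀ k, |u k - v k| ≤ c) →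
      (⨆ k, u k) ≤ (⨆ k, v k) + c := fun {u v} hv h => ciSup_le fun k => by
    have := le_ciSup (bddAbove_range_of_abs_le hv) k
    linarith [(abs_le.1 (h k)).2]
  have h1 := key hv h
  have h2 := key hu fun k => (abs_sub_comm (v k) (u k)).trans_le (h k)
  exact abs_le.2 ⟨by linarith, by linarith⟩

lemma abs_sign (s : ℤˣ) : |((s : ℤ) : ℝ)| = 1 := by
  rcases Int.units_eq_one_or s with rfl | rfl <;> simp

lemma abs_sum_sign_mul_le {m : ℕ} (σ : Fin m → ℤˣ) {v : Fin m → ℝ} {C : ℝ}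
    (hv : ∀ i, |v i| ≤ C) : |∑ i, ((σ i : ℤ) : ℝ) * v i| ≤ m * C := by
  refine (Finset.abs_sum_le_sum_abs _ _).trans ?_
  calc ∑ i, |((σ i : ℤ) : ℝ) * v i| ≤ ∑ _i : Fin m, C :=
        Finset.sum_le_sum fun i _ => by simpa [abs_mul, abs_sign] using hv i
    _ = m * C := by simp

/-- Contraction in a single sign. For indices `k`, `l` the left side contributes at most `a k + a l
+ |v k - v l|`; the sign of `v k - v l` decides which index goes into which supremum on the right.
-/
lemma ciSup_add_add_ciSup_sub_le {ι : Type*} [Nonempty ι] {a u v : ι → ℝ} {C₁ C₂ : ℝ}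
    (ha : ∀ k, |a k| ≤ C₁) (hv : ∀ k, |v k| ≤ C₂)
    (huv : ∀ k l, |u k - u l| ≤ |v k - v l|) :
    (⨆ k, (a k + u k)) + (⨆ k, (a k - u k)) ≤ (⨆ k, (a k + v k)) + ⨆ k, (a k - v k) := by
  have hp := bddAbove_range_of_abs_le fun k => (abs_add_le (a k) (v k)).trans
    (add_le_add (ha k) (hv k))
  have hn := bddAbove_range_of_abs_le fun k => (abs_sub (a k) (v k)).trans
    (add_le_add (ha k) (hv k))
  rw [← le_sub_iff_add_le]
  refine ciSup_le fun k => ?_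
  rw [le_sub_comm]
  refine ciSup_le fun l => ?_
  have h := (le_abs_self _).trans (huv k l)
  have h1 := le_ciSup hp k
  have h2 := le_ciSup hp l
  have h3 := le_ciSup hn k
  have h4 := le_ciSup hn l
  rcases abs_cases (v k - v l) with ⟨h0, -⟩ | ⟨h0, -⟩ <;> linarith

lemma sum_sign_succ {n : ℕ} (F : (Fin (n + 1) → ℤˣ) → ℝ) :
    ∑ σ, F σ = (∑ σ : Fin n → ℤˣ, F (Fin.cons 1 σ)) +
      ∑ σ : Fin n → ℤˣ, F (Fin.cons (-1) σ) := by
  rw [← (Fin.consEquiv fun _ : Fin (n + 1) => ℤˣ).sum_comp, Fintype.sum_prod_type,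
    UnitsInt.univ, Finset.sum_pair (by decide)]
  rfl

/-- The Ledoux–Talagrand contraction principle, summed over all sign vectors. -/
theorem sum_ciSup_contraction {ι : Type*} [Nonempty ι] {n : ℕ} {a : ι → ℝ} {u v : ι → Fin n → ℝ}
    {C₁ C₂ C₃ : ℝ} (ha : ∀ k, |a k| ≤ C₁) (hu : ∀ k i, |u k i| ≤ C₂) (hv : ∀ k i, |v k i| ≤ C₃)
    (huv : ∀ k l i, |u k i - u l i| ≤ |v k i - v l i|) :
    ∑ σ : Fin n → ℤˣ, ⨆ k, (a k + ∑ i, ((σ i : ℤ) : ℝ) * u k i) ≤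
      ∑ σ : Fin n → ℤˣ, ⨆ k, (a k + ∑ i, ((σ i : ℤ) : ℝ) * v k i) := by
  induction n generalizing a C₁ with
  | zero => simp
  | succ n ih =>
    -- With the first sign fixed, its term is absorbed into the offset `a`, and induction replaces
    -- the tail of `u` by that of `v`. Pairing the signs `1` and `-1` then treats the first
    -- coordinate.
    have step (s : ℤˣ) := ih (a := fun k => a k + (s : ℤ) * u k 0) (C₁ := C₁ + C₂)
      (u := fun k i => u k i.succ) (v := fun k i => v k i.succ)
      (fun k => (abs_add_le _ _).trans (add_le_add (ha k)
        (by simpa [abs_mul, abs_sign] using hu k 0)))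
      (fun k i => hu k _) (fun k i => hv k _) (fun k l i => huv k l _)
    have h1 := step 1
    have h2 := step (-1)
    rw [sum_sign_succ, sum_sign_succ]
    simp only [Fin.sum_univ_succ, Fin.cons_zero, Fin.cons_succ, Units.val_one, Int.cast_one,
      one_mul, Units.val_neg, Int.cast_neg, ← add_assoc, neg_mul] at h1 h2 ⊢
    refine (add_le_add h1 h2).trans ?_
    rw [← Finset.sum_add_distrib, ← Finset.sum_add_distrib]
    refine Finset.sum_le_sum fun σ _ => ?_
    have := ciSup_add_add_ciSup_sub_le (a := fun k => a k + ∑ i, ((σ i : ℤ) : ℝ) * v k i.succ)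
      (u := fun k => u k 0) (v := fun k => v k 0) (C₁ := C₁ + n * C₃)
      (fun k => (abs_add_le _ _).trans (add_le_add (ha k)
        (abs_sum_sign_mul_le σ fun i => hv k i.succ)))
      (fun k => hv k 0) (fun k l => huv k l 0)
    simpa only [← sub_eq_add_neg, add_right_comm, add_sub_right_comm] using this

/-! ### Empirical Rademacher averages -/

/-- The normalized signed sum `(1 / m) * ∑ i, σ i * v i`. -/
def signMean {m : ℕ} (σ : Fin m → ℤˣ) (v : Fin m → ℝ) : ℝ :=
  (1 / (m : ℝ)) * ∑ i, ((σ i : ℤ) : ℝ) * v i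

lemma abs_signMean_le {m : ℕ} (σ : Fin m → ℤˣ) {v : Fin m → ℝ} {C : ℝ} (hC : 0 ≤ C)
    (hv : ∀ i, |v i| ≤ C) : |signMean σ v| ≤ C := by
  rw [signMean, abs_mul, abs_of_nonneg (by positivity)]
  refine (mul_le_mul_of_nonneg_left (abs_sum_sign_mul_le σ hv) (by positivity)).trans ?_
  rcases Nat.eq_zero_or_pos m with rfl | hm
  · simpa using hC
  · have : (m : ℝ) ≠ 0 := by positivity
    exact le_of_eq (by field_simp)

lemma signMean_neg {m : ℕ} (σ : Fin m → ℤˣ) (v : Fin m → ℝ) :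
    signMean (-σ) v = -signMean σ v := by
  simp [signMean, Finset.sum_neg_distrib]

lemma signMean_sum {m : ℕ} {κ : Type*} (s : Finset κ) (σ : Fin m → ℤˣ) (w : κ → ℝ)
    (v : κ → Fin m → ℝ) :
    signMean σ (fun i => ∑ j ∈ s, w j * v j i) = ∑ j ∈ s, w j * signMean σ (v j) := by
  simp only [signMean, Finset.mul_sum]
  rw [Finset.sum_comm]
  exact Finset.sum_congr rfl fun j _ => Finset.sum_congr rfl fun i _ => by ring

/-- Empirical Rademacher complexity of a family of value vectors. -/
def rademacherAverage {ι : Type*} {m : ℕ} (v : ι → Fin m → ℝ) : ℝ :=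
  (1 / (2 : ℝ) ^ m) * ∑ σ : Fin m → ℤˣ, ⨆ k, signMean σ (v k)

lemma empiricalRademacher_eq {X : Type*} {m : ℕ} (𝓕 : Set (X → ℝ)) (x : Fin m → X) :
    empiricalRademacher 𝓕 x = rademacherAverage fun (f : 𝓕) i => (f : X → ℝ) (x i) := rfl

lemma sum_sign_neg {m : ℕ} (F : (Fin m → ℤˣ) → ℝ) : ∑ σ, F (-σ) = ∑ σ, F σ :=
  Equiv.sum_comp (Equiv.neg (Fin m → ℤˣ)) F

lemma card_sign (m : ℕ) : Fintype.card (Fin m → ℤˣ) = 2 ^ m := by simp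

lemma average_sign_le {m : ℕ} {F : (Fin m → ℤˣ) → ℝ} {c : ℝ} (h : ∀ σ, F σ ≤ c) :
    (1 / (2 : ℝ) ^ m) * ∑ σ, F σ ≤ c := by
  calc (1 / (2 : ℝ) ^ m) * ∑ σ, F σ ≤ (1 / (2 : ℝ) ^ m) * ∑ _σ : Fin m → ℤˣ, c := by
        gcongr with σ; exact h σ
    _ = c := by
        rw [Finset.sum_const, Finset.card_univ, card_sign, nsmul_eq_mul]
        push_cast
        field_simp

lemma abs_rademacherAverage_le {ι : Type*} [Nonempty ι] {m : ℕ} {v : ι → Fin m → ℝ} {C : ℝ}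
    (hC : 0 ≤ C) (hv : ∀ k i, |v k i| ≤ C) : |rademacherAverage v| ≤ C := by
  rw [rademacherAverage, abs_mul, abs_of_nonneg (by positivity)]
  exact (mul_le_mul_of_nonneg_left (Finset.abs_sum_le_sum_abs _ _) (by positivity)).trans
    (average_sign_le fun σ => abs_ciSup_le fun k => abs_signMean_le σ hC (hv k))

/-- The supremum dominates any single member, whose average over the signs vanishes by the symmetry
`σ ↦ -σ`. -/
lemma rademacherAverage_nonneg {ι : Type*} [Nonempty ι] {m : ℕ} {v : ι → Fin m → ℝ} {C : ℝ}
    (hC : 0 ≤ C) (hv : ∀ k i, |v k i| ≤ C) : 0 ≤ rademacherAverage v := by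
  obtain ⟨k⟩ := ‹Nonempty ι›
  have h0 : ∑ σ : Fin m → ℤˣ, signMean σ (v k) = 0 := by
    have := sum_sign_neg fun σ => signMean σ (v k)
    simp only [signMean_neg, Finset.sum_neg_distrib] at this
    linarith
  refine mul_nonneg (by positivity) (h0.symm.trans_le (Finset.sum_le_sum fun σ _ => ?_))
  exact le_ciSup (f := fun k => signMean σ (v k))
    (bddAbove_range_of_abs_le fun k => abs_signMean_le σ hC (hv k)) k

lemma rademacherAverage_contraction {ι : Type*} [Nonempty ι] {m : ℕ} {u v : ι → Fin m → ℝ}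
    {C₁ C₂ L : ℝ} (hL : 0 ≤ L) (hu : ∀ k i, |u k i| ≤ C₁) (hv : ∀ k i, |v k i| ≤ C₂)
    (huv : ∀ k l i, |u k i - u l i| ≤ L * |v k i - v l i|) :
    rademacherAverage u ≤ L * rademacherAverage v := by
  have h := sum_ciSup_contraction (a := fun _ => 0) (C₁ := 0) (C₂ := 1 / m * C₁)
    (C₃ := 1 / m * L * C₂) (u := fun k i => 1 / m * u k i) (v := fun k i => 1 / m * L * v k i)
    (by simp)
    (fun k i => by
      rw [abs_mul, abs_of_nonneg (by positivity)]
      exact mul_le_mul_of_nonneg_left (hu k i) (by positivity))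
    (fun k i => by
      rw [abs_mul, abs_of_nonneg (by positivity)]
      exact mul_le_mul_of_nonneg_left (hv k i) (by positivity))
    (fun k l i => by
      rw [← mul_sub, ← mul_sub, abs_mul, abs_mul (_ * L), abs_of_nonneg (a := 1 / (m : ℝ))
        (by positivity), abs_of_nonneg (a := 1 / (m : ℝ) * L) (by positivity), mul_assoc]
      exact mul_le_mul_of_nonneg_left (huv k l i) (by positivity))
  rw [rademacherAverage, rademacherAverage, mul_left_comm]
  refine mul_le_mul_of_nonneg_left ?_ (by positivity)
  rw [Finset.mul_sum]
  simp only [Real.mul_iSup_of_nonneg hL]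
  have hl (σ : Fin m → ℤˣ) (k : ι) :
      signMean σ (u k) = 0 + ∑ i, ((σ i : ℤ) : ℝ) * (1 / m * u k i) := by
    rw [signMean, Finset.mul_sum, zero_add]
    exact Finset.sum_congr rfl fun i _ => by ring
  have hr (σ : Fin m → ℤˣ) (k : ι) :
      L * signMean σ (v k) = 0 + ∑ i, ((σ i : ℤ) : ℝ) * (1 / m * L * v k i) := by
    rw [signMean, Finset.mul_sum, Finset.mul_sum, zero_add]
    exact Finset.sum_congr rfl fun i _ => by ring
  simpa only [hl, hr] using h

/-- A fixed linear combination of members of a class. -/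
lemma rademacherAverage_linear_le {ι κ : Type*} [Nonempty ι] [Nonempty κ] {m D : ℕ}
    {u : κ → Fin m → ℝ} {C : ℝ} (hC : 0 ≤ C) (hu : ∀ f i, |u f i| ≤ C) (w : Fin D → ℝ)
    (φ : ι → Fin D → κ) :
    rademacherAverage (fun k i => ∑ j, w j * u (φ k j) i) ≤ D * ‖w‖ * rademacherAverage u := by
  have hb (σ : Fin m → ℤˣ) (f : κ) : |signMean σ (u f)| ≤ C := abs_signMean_le σ hC (hu f)
  -- A negative weight is absorbed by `σ ↦ -σ`, so a fixed `w` costs no factor `2`.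
  have hsingle (c : ℝ) : (1 / (2 : ℝ) ^ m) * ∑ σ : Fin m → ℤˣ, ⨆ f, c * signMean σ (u f) =
      |c| * rademacherAverage u := by
    rw [rademacherAverage, mul_left_comm]
    congr 1
    rw [Finset.mul_sum]
    rcases le_total 0 c with hc | hc
    · simp only [abs_of_nonneg hc, Real.mul_iSup_of_nonneg hc]
    · rw [← sum_sign_neg]
      simp only [abs_of_nonpos hc, Real.mul_iSup_of_nonneg (neg_nonneg.2 hc), signMean_neg,
        mul_neg, neg_mul]
  calc rademacherAverage (fun k i => ∑ j, w j * u (φ k j) i)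
      ≤ (1 / (2 : ℝ) ^ m) * ∑ σ : Fin m → ℤˣ, ∑ j, ⨆ f, w j * signMean σ (u f) := by
        refine mul_le_mul_of_nonneg_left (Finset.sum_le_sum fun σ _ => ?_) (by positivity)
        refine ciSup_le fun k => ?_
        rw [signMean_sum]
        refine Finset.sum_le_sum fun j _ => ?_
        refine le_ciSup (f := fun f => w j * signMean σ (u f))
          (bddAbove_range_of_abs_le (C := |w j| * C) fun f => ?_) (φ k j)
        rw [abs_mul]
        exact mul_le_mul_of_nonneg_left (hb σ f) (abs_nonneg _)
    _ = ∑ j, |w j| * rademacherAverage u := by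
        rw [Finset.sum_comm, Finset.mul_sum]
        exact Finset.sum_congr rfl fun j _ => hsingle _
    _ ≤ ∑ _j : Fin D, ‖w‖ * rademacherAverage u := by
        gcongr with j
        · exact rademacherAverage_nonneg hC hu
        · exact norm_le_pi_norm w j
    _ = D * ‖w‖ * rademacherAverage u := by simp [mul_assoc]

/-- Linear combinations, with weights in a sup norm ball, of members of a class that contains
zero. -/
lemma rademacherAverage_linear_ball_le {ι κ : Type*} [Nonempty ι] {m D : ℕ}
    {u : κ → Fin m → ℝ} {C W : ℝ} (hC : 0 ≤ C) (hu : ∀ f i, |u f i| ≤ C) (f₀ : κ)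
    (hf₀ : ∀ i, u f₀ i = 0) (w : ι → Fin D → ℝ) (hw : ∀ k, ‖w k‖ ≤ W) (φ : ι → Fin D → κ) :
    rademacherAverage (fun k i => ∑ j, w k j * u (φ k j) i) ≤
      2 * D * W * rademacherAverage u := by
  have hb (σ : Fin m → ℤˣ) : BddAbove (Set.range fun f => signMean σ (u f)) :=
    bddAbove_range_of_abs_le fun f => abs_signMean_le σ hC (hu f)
  set T : (Fin m → ℤˣ) → ℝ := fun σ => ⨆ f, signMean σ (u f) with hT
  have hle (σ f) : signMean σ (u f) ≤ T σ := le_ciSup (hb σ) f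
  -- The zero function makes both `T σ` and `T (-σ)` nonnegative, so their sum bounds `|signMean σ
  -- (u f)|`. The weights vary with `k`, so their signs are unknown and the absolute value is
  -- needed; this is the source of the factor `2`.
  have hT0 (σ) : 0 ≤ T σ := le_trans (by simp [signMean, hf₀]) (hle σ f₀)
  calc rademacherAverage (fun k i => ∑ j, w k j * u (φ k j) i)
      ≤ (1 / (2 : ℝ) ^ m) * ∑ σ : Fin m → ℤˣ, D * W * (T σ + T (-σ)) := by
        refine mul_le_mul_of_nonneg_left (Finset.sum_le_sum fun σ _ => ?_) (by positivity)
        refine ciSup_le fun k => ?_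
        rw [signMean_sum]
        calc ∑ j, w k j * signMean σ (u (φ k j)) ≤ ∑ _j : Fin D, W * (T σ + T (-σ)) := by
              refine Finset.sum_le_sum fun j _ => ?_
              refine (le_abs_self _).trans ?_
              rw [abs_mul]
              refine mul_le_mul ((norm_le_pi_norm (w k) j).trans (hw k)) ?_ (abs_nonneg _)
                ((norm_nonneg _).trans (hw k))
              have h1 := hle σ (φ k j)
              have h2 := hle (-σ) (φ k j)
              rw [signMean_neg] at h2
              exact abs_le.2 ⟨by linarith [hT0 σ], by linarith [hT0 (-σ)]⟩
          _ = D * W * (T σ + T (-σ)) := by simp [mul_assoc]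
    _ = 2 * D * W * rademacherAverage u := by
        rw [← Finset.mul_sum, Finset.sum_add_distrib, sum_sign_neg, rademacherAverage]
        ring

/-! ### Exponential moments and McDiarmid's inequality -/

lemma integrable_of_abs_le {Z : Type*} [MeasurableSpace Z] {μ : Measure Z} [IsFiniteMeasure μ]
    {f : Z → ℝ} (hf : Measurable f) {C : ℝ} (h : ∀ z, |f z| ≤ C) : Integrable f μ :=
  .of_bound hf.aestronglyMeasurable C (ae_of_all _ h)

lemma abs_integral_le {Z : Type*} [MeasurableSpace Z] {μ : Measure Z} [IsProbabilityMeasure μ]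
    {f : Z → ℝ} {C : ℝ} (h : ∀ z, |f z| ≤ C) : |∫ z, f z ∂μ| ≤ C := by
  have := norm_integral_le_of_norm_le_const (μ := μ) (f := f) (C := C) (ae_of_all _ h)
  simpa using this

/-- Hoeffding's lemma: a function of oscillation at most `c` takes values in an interval of length
`c` starting at its infimum. -/
lemma integral_exp_sub_integral_le {Z : Type*} [MeasurableSpace Z] (μ : Measure Z)
    [IsProbabilityMeasure μ] {g : Z → ℝ} (hg : Measurable g) {C c : ℝ} (hC : ∀ z, |g z| ≤ C)
    (hc : ∀ z z', |g z - g z'| ≤ c) (t : ℝ) :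
    ∫ z, Real.exp (t * (g z - ∫ z', g z' ∂μ)) ∂μ ≤ Real.exp (c ^ 2 * t ^ 2 / 8) := by
  have : Nonempty Z := nonempty_of_isProbabilityMeasure μ
  have hbdd : BddBelow (Set.range g) :=
    ⟨-C, by rintro _ ⟨z, rfl⟩; exact neg_le_of_abs_le (hC z)⟩
  have hIcc (z) : g z ∈ Set.Icc (⨅ z, g z) ((⨅ z, g z) + c) := by
    refine ⟨ciInf_le hbdd z, ?_⟩
    rw [← sub_le_iff_le_add]
    exact le_ciInf fun z' => by linarith [(abs_le.1 (hc z z')).2]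
  have h := (ProbabilityTheory.hasSubgaussianMGF_of_mem_Icc (μ := μ) hg.aemeasurable
    (ae_of_all _ hIcc)).mgf_le t
  refine h.trans (Real.exp_le_exp.2 (le_of_eq ?_))
  simp [div_pow]
  ring

lemma integral_pi_succ {Z : Type*} [MeasurableSpace Z] (μ : Measure Z) [IsProbabilityMeasure μ]
    {n : ℕ} {F : (Fin (n + 1) → Z) → ℝ} (hF : Measurable F) {C : ℝ} (hC : ∀ S, |F S| ≤ C) :
    ∫ S, F S ∂(Measure.pi fun _ => μ) =
      ∫ z, ∫ S, F (Fin.cons z S) ∂(Measure.pi fun _ => μ) ∂μ := by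
  have hmp := (measurePreserving_piFinSuccAbove (fun _ : Fin (n + 1) => μ) 0).symm
  rw [← hmp.integral_comp' F]
  rw [integral_prod]
  · simp [MeasurableEquiv.piFinSuccAbove, Fin.insertNthEquiv]
  · exact integrable_of_abs_le (hF.comp (MeasurableEquiv.measurable _)) fun _ => hC _

lemma measurable_fin_cons {Z : Type*} [MeasurableSpace Z] {n : ℕ} :
    Measurable fun p : Z × (Fin n → Z) => (Fin.cons p.1 p.2 : Fin (n + 1) → Z) := by
  refine measurable_pi_lambda _ fun i => ?_
  refine Fin.cases ?_ (fun j => ?_) i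
  · simpa using measurable_fst
  · simpa [Function.comp_def] using (measurable_pi_apply j).comp measurable_snd

/-- The exponential moment bound behind McDiarmid's inequality. -/
theorem integral_exp_boundedDifferences_le {Z : Type*} [MeasurableSpace Z] (μ : Measure Z)
    [IsProbabilityMeasure μ] {n : ℕ} {f : (Fin n → Z) → ℝ} (hf : Measurable f) {C c : ℝ}
    (hC : ∀ S, |f S| ≤ C) (hc : ∀ S i z, |f (Function.update S i z) - f S| ≤ c) (t : ℝ) :
    ∫ S, Real.exp (t * (f S - ∫ S', f S' ∂(Measure.pi fun _ => μ))) ∂(Measure.pi fun _ => μ) ≤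
      Real.exp (n * (c ^ 2 * t ^ 2 / 8)) := by
  induction n with
  | zero =>
    have h (S : Fin 0 → Z) : f S = f default := congrArg f (Subsingleton.elim _ _)
    simp [h]
  | succ n ih =>
    set ν : Measure (Fin n → Z) := Measure.pi fun _ => μ
    have hfc : Measurable fun p : Z × (Fin n → Z) => f (Fin.cons p.1 p.2) :=
      hf.comp measurable_fin_cons
    have hfz (z : Z) : Measurable fun S : Fin n → Z => f (Fin.cons z S) :=
      hfc.comp measurable_prodMk_left
    -- Averaging out the tail leaves a function of the first coordinate that inherits the difference
    -- bound `c`. Hoeffding's lemma handles `g`, and induction handles the fluctuation of the tail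
    -- around `g z`.
    set g : Z → ℝ := fun z => ∫ S, f (Fin.cons z S) ∂ν with hgdef
    have hg : Measurable g := hfc.stronglyMeasurable.integral_prod_right.measurable
    have hgC (z) : |g z| ≤ C := abs_integral_le fun S => hC _
    have hgc (z z') : |g z - g z'| ≤ c := by
      rw [hgdef, ← integral_sub (integrable_of_abs_le (hfz z) fun _ => hC _)
        (integrable_of_abs_le (hfz z') fun _ => hC _)]
      refine abs_integral_le fun S => ?_
      simpa using hc (Fin.cons z' S) 0 z
    have hmean : ∫ S, f S ∂(Measure.pi fun _ => μ) = ∫ z, g z ∂μ := integral_pi_succ μ hf hC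
    have hgm := abs_integral_le (μ := μ) hgC
    have hexp {a b : ℝ} (ha : |a| ≤ C) (hb : |b| ≤ C) :
        |Real.exp (t * (a - b))| ≤ Real.exp (|t| * (C + C)) := by
      rw [abs_of_pos (Real.exp_pos _), Real.exp_le_exp]
      refine (le_abs_self _).trans ?_
      rw [abs_mul]
      exact mul_le_mul_of_nonneg_left ((abs_sub _ _).trans (add_le_add ha hb)) (abs_nonneg _)
    rw [hmean, integral_pi_succ μ (by fun_prop) (fun S => hexp (hC S) hgm)]
    have hinner (z : Z) : ∫ S, Real.exp (t * (f (Fin.cons z S) - ∫ z, g z ∂μ)) ∂ν ≤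
        Real.exp (t * (g z - ∫ z, g z ∂μ)) * Real.exp (n * (c ^ 2 * t ^ 2 / 8)) := by
      have hz := ih (hfz z) (fun S => hC _) fun S i z' => by
        simpa [Fin.cons_update] using hc (Fin.cons z S) i.succ z'
      refine le_trans (le_of_eq ?_) (mul_le_mul_of_nonneg_left hz (Real.exp_pos _).le)
      rw [← integral_const_mul]
      refine integral_congr_ae (ae_of_all _ fun S => ?_)
      simp only [← Real.exp_add]
      congr 1
      simp only [hgdef, ν]
      ring
    calc ∫ z, ∫ S, Real.exp (t * (f (Fin.cons z S) - ∫ z, g z ∂μ)) ∂ν ∂μ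
        ≤ ∫ z, Real.exp (t * (g z - ∫ z, g z ∂μ)) * Real.exp (n * (c ^ 2 * t ^ 2 / 8)) ∂μ := by
          refine integral_mono ?_ ?_ hinner
          · refine integrable_of_abs_le (C := Real.exp (|t| * (C + C))) ?_
              fun z => abs_integral_le fun S => hexp (hC _) hgm
            exact (((hfc.sub_const _).const_mul t).exp.stronglyMeasurable
              |>.integral_prod_right).measurable
          · exact integrable_of_abs_le (C := Real.exp (|t| * (C + C)))
              (by fun_prop) (fun z => hexp (hgC z) hgm) |>.mul_const _
      _ = (∫ z, Real.exp (t * (g z - ∫ z, g z ∂μ)) ∂μ) * Real.exp (n * (c ^ 2 * t ^ 2 / 8)) :=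
          integral_mul_const _ _
      _ ≤ Real.exp (c ^ 2 * t ^ 2 / 8) * Real.exp (n * (c ^ 2 * t ^ 2 / 8)) :=
          mul_le_mul_of_nonneg_right (integral_exp_sub_integral_le μ hg hgC hgc t)
            (Real.exp_pos _).le
      _ = Real.exp ((n + 1 : ℕ) * (c ^ 2 * t ^ 2 / 8)) := by
          rw [← Real.exp_add]
          congr 1
          push_cast
          ring

/-- McDiarmid's bounded differences inequality. -/
theorem measure_boundedDifferences_ge_le {Z : Type*} [MeasurableSpace Z] (μ : Measure Z)
    [IsProbabilityMeasure μ] {n : ℕ} (hn : 1 ≤ n) {f : (Fin n → Z) → ℝ} (hf : Measurable f)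
    {C c : ℝ} (hC : ∀ S, |f S| ≤ C) (hc0 : 0 < c)
    (hc : ∀ S i z, |f (Function.update S i z) - f S| ≤ c) {ε : ℝ} (hε : 0 ≤ ε) :
    (Measure.pi fun _ => μ).real {S | ε ≤ f S - ∫ S', f S' ∂(Measure.pi fun _ => μ)} ≤
      Real.exp (-2 * ε ^ 2 / (n * c ^ 2)) := by
  have hn' : (0 : ℝ) < n := by exact_mod_cast hn
  -- This is the minimizer of the Chernoff exponent `-t * ε + n * c ^ 2 * t ^ 2 / 8`.
  have ht : 0 ≤ 4 * ε / (n * c ^ 2) := by positivity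
  have hm := abs_integral_le (μ := Measure.pi fun _ : Fin n => μ) hC
  have h := ProbabilityTheory.measure_ge_le_exp_mul_mgf (μ := Measure.pi fun _ : Fin n => μ)
    (X := fun S => f S - ∫ S', f S' ∂(Measure.pi fun _ => μ)) ε ht ?_
  · refine h.trans ((mul_le_mul_of_nonneg_left
      (integral_exp_boundedDifferences_le μ hf hC hc _) (Real.exp_pos _).le).trans ?_)
    rw [← Real.exp_add, Real.exp_le_exp]
    refine le_of_eq ?_
    field_simp
    ring
  · refine integrable_of_abs_le (C := Real.exp (|4 * ε / (n * c ^ 2)| * (C + C))) (by fun_prop)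
      fun S => ?_
    rw [abs_of_pos (Real.exp_pos _), Real.exp_le_exp]
    refine (le_abs_self _).trans ?_
    rw [abs_mul]
    exact mul_le_mul_of_nonneg_left ((abs_sub _ _).trans (add_le_add (hC S) hm)) (abs_nonneg _)

/-! ### Symmetrization and uniform deviation -/

lemma signMean_sub {m : ℕ} (σ : Fin m → ℤˣ) (u v : Fin m → ℝ) :
    signMean σ (fun i => u i - v i) = signMean σ u - signMean σ v := by
  simp only [signMean, mul_sub, Finset.sum_sub_distrib]

lemma measurable_signMean {Z : Type*} [MeasurableSpace Z] {m : ℕ} (σ : Fin m → ℤˣ)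
    {v : Z → Fin m → ℝ} (hv : ∀ i, Measurable fun z => v z i) :
    Measurable fun z => signMean σ (v z) :=
  (Finset.measurable_sum _ fun i _ => (hv i).const_mul _).const_mul _

lemma measurable_rademacherAverage {ι Z : Type*} [Countable ι] [MeasurableSpace Z] {m : ℕ}
    {v : Z → ι → Fin m → ℝ} (hv : ∀ k i, Measurable fun z => v z k i) :
    Measurable fun z => rademacherAverage (v z) :=
  (Finset.measurable_sum _ fun σ _ => Measurable.iSup fun k =>
    measurable_signMean σ (hv k)).const_mul _

section Symmetrization

variable {ι Z : Type*} [Countable ι] [MeasurableSpace Z] (μ : Measure Z)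
  [IsProbabilityMeasure μ] {m : ℕ} {ℓ : ι → Z → ℝ} {C : ℝ}

/-- Swapping the two entries of the `i`-th pair whenever `σ i = -1` preserves the product measure
and flips exactly those differences. -/
lemma integral_ciSup_signMean_sub (hℓ : ∀ k, Measurable (ℓ k)) (σ : Fin m → ℤˣ) :
    ∫ p : Fin m → Z × Z, ⨆ k, signMean σ (fun i => ℓ k (p i).2 - ℓ k (p i).1)
        ∂(Measure.pi fun _ => μ.prod μ) =
      ∫ p : Fin m → Z × Z, ⨆ k, signMean 1 (fun i => ℓ k (p i).2 - ℓ k (p i).1)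
        ∂(Measure.pi fun _ => μ.prod μ) := by
  have hmp : MeasurePreserving
      (fun (p : Fin m → Z × Z) i => (if σ i = 1 then id else Prod.swap) (p i))
      (Measure.pi fun _ => μ.prod μ) (Measure.pi fun _ => μ.prod μ) := by
    refine measurePreserving_pi _ _ (f := fun i => if σ i = 1 then id else Prod.swap) fun i => ?_
    split_ifs
    · exact MeasurePreserving.id _
    · exact Measure.measurePreserving_swap
  have hmeas : Measurable fun p : Fin m → Z × Z =>
      ⨆ k, signMean 1 (fun i => ℓ k (p i).2 - ℓ k (p i).1) :=
    Measurable.iSup fun k => measurable_signMean _ fun i =>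
      ((hℓ k).comp (measurable_pi_apply i).snd).sub ((hℓ k).comp (measurable_pi_apply i).fst)
  conv_rhs => rw [← hmp.map_eq]
  rw [integral_map hmp.measurable.aemeasurable hmeas.aestronglyMeasurable]
  refine integral_congr_ae (ae_of_all _ fun p => ?_)
  refine iSup_congr fun k => ?_
  simp only [signMean]
  congr 1
  refine Finset.sum_congr rfl fun i _ => ?_
  rcases Int.units_eq_one_or (σ i) with h | h <;> simp [h]

lemma integral_mean_comp_eval (hm : 1 ≤ m) {g : Z → ℝ} (hg : Measurable g)
    (hC : ∀ z, |g z| ≤ C) :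
    ∫ S : Fin m → Z, (1 / (m : ℝ)) * ∑ i, g (S i) ∂(Measure.pi fun _ => μ) = ∫ z, g z ∂μ := by
  have hm' : (m : ℝ) ≠ 0 := by positivity
  have h (i : Fin m) : ∫ S : Fin m → Z, g (S i) ∂(Measure.pi fun _ => μ) = ∫ z, g z ∂μ := by
    have hmp := measurePreserving_eval (fun _ : Fin m => μ) i
    conv_rhs => rw [← hmp.map_eq]
    exact (integral_map hmp.measurable.aemeasurable hg.aestronglyMeasurable).symm
  rw [integral_const_mul, integral_finsetSum _ fun i _ =>
    integrable_of_abs_le (f := fun S : Fin m → Z => g (S i)) (hg.comp (measurable_pi_apply i))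
      fun S => hC _]
  simp only [h]
  simp [hm']

/-- Ghost sample: the expectation is the mean over an independent second sample, and pulling that
integral out of the supremum only increases the value. Random signs can then be inserted for free,
and the two samples separate into two equal terms. -/
lemma integral_ciSup_gap_le [Nonempty ι] (hm : 1 ≤ m) (hC0 : 0 ≤ C) (hℓ : ∀ k, Measurable (ℓ k))
    (hC : ∀ k z, |ℓ k z| ≤ C) :
    ∫ S : Fin m → Z, ⨆ k, (∫ z, ℓ k z ∂μ - (1 / (m : ℝ)) * ∑ i, ℓ k (S i))
        ∂(Measure.pi fun _ => μ) ≤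
      2 * ∫ S : Fin m → Z, rademacherAverage (fun k i => ℓ k (S i)) ∂(Measure.pi fun _ => μ) := by
  set ν : Measure (Fin m → Z) := Measure.pi fun _ => μ
  have hS (k : ι) (i : Fin m) : Measurable fun S : Fin m → Z => ℓ k (S i) :=
    (hℓ k).comp (measurable_pi_apply i)
  have hT (σ : Fin m → ℤˣ) : Measurable fun S : Fin m → Z => ⨆ k, signMean σ fun i => ℓ k (S i) :=
    Measurable.iSup fun k => measurable_signMean _ (hS k)
  have hTint (σ : Fin m → ℤˣ) : Integrable (fun S => ⨆ k, signMean σ fun i => ℓ k (S i)) ν :=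
    integrable_of_abs_le (hT σ) fun S => abs_ciSup_le fun k => abs_signMean_le σ hC0 fun i => hC k _
  have hdiff (k : ι) (z z' : Z) : |ℓ k z - ℓ k z'| ≤ C + C :=
    (abs_sub _ _).trans (add_le_add (hC k z) (hC k z'))
  let Q : (Fin m → ℤˣ) → (Fin m → Z) × (Fin m → Z) → ℝ :=
    fun σ p => ⨆ k, signMean σ (fun i => ℓ k (p.2 i) - ℓ k (p.1 i))
  have hQm (σ) : Measurable (Q σ) := Measurable.iSup fun k => measurable_signMean _ fun i =>
    ((hS k i).comp measurable_snd).sub ((hS k i).comp measurable_fst)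
  have hQb (σ) (p) : |Q σ p| ≤ C + C :=
    abs_ciSup_le fun k => abs_signMean_le σ (by positivity) fun i => hdiff k _ _
  have hQint (σ) : Integrable (Q σ) (ν.prod ν) := integrable_of_abs_le (hQm σ) (hQb σ)
  have hQ1 (σ) : ∫ p, Q σ p ∂(ν.prod ν) = ∫ p, Q 1 p ∂(ν.prod ν) := by
    have hmp := measurePreserving_arrowProdEquivProdArrow Z Z (Fin m) (fun _ => μ) (fun _ => μ)
    rw [← hmp.integral_comp' (Q σ), ← hmp.integral_comp' (Q 1)]
    exact integral_ciSup_signMean_sub μ hℓ σ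
  have hghost (S : Fin m → Z) : (⨆ k, (∫ z, ℓ k z ∂μ - (1 / (m : ℝ)) * ∑ i, ℓ k (S i))) ≤
      ∫ S', Q 1 (S, S') ∂ν := by
    refine ciSup_le fun k => ?_
    have hmeas : Measurable fun S : Fin m → Z => (1 / (m : ℝ)) * ∑ i, ℓ k (S i) :=
      (Finset.measurable_sum _ fun i _ => hS k i).const_mul _
    have hmeanb (S : Fin m → Z) : |(1 / (m : ℝ)) * ∑ i, ℓ k (S i)| ≤ C := by
      simpa [signMean] using abs_signMean_le (1 : Fin m → ℤˣ) hC0 fun i => hC k (S i)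
    have hint := integrable_of_abs_le (μ := ν) hmeas hmeanb
    calc ∫ z, ℓ k z ∂μ - (1 / (m : ℝ)) * ∑ i, ℓ k (S i)
        = ∫ S', ((1 / (m : ℝ)) * ∑ i, ℓ k (S' i) - (1 / (m : ℝ)) * ∑ i, ℓ k (S i)) ∂ν := by
          rw [integral_sub hint (integrable_const _), integral_mean_comp_eval μ hm (hℓ k) (hC k)]
          simp
      _ ≤ ∫ S', Q 1 (S, S') ∂ν := by
          refine integral_mono (hint.sub (integrable_const _))
            (integrable_of_abs_le ((hQm 1).comp measurable_prodMk_left) fun S' => hQb _ _)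
            fun S' => ?_
          refine le_trans (le_of_eq ?_) (le_ciSup (bddAbove_range_of_abs_le fun k =>
            abs_signMean_le 1 (add_nonneg hC0 hC0) fun i => hdiff k _ _) k)
          rw [signMean_sub]
          simp [signMean]
  have hgapm : Measurable fun S : Fin m → Z =>
      ⨆ k, (∫ z, ℓ k z ∂μ - (1 / (m : ℝ)) * ∑ i, ℓ k (S i)) :=
    Measurable.iSup fun k => ((Finset.measurable_sum _ fun i _ => hS k i).const_mul _).const_sub _
  have hgapb (S : Fin m → Z) :
      |⨆ k, (∫ z, ℓ k z ∂μ - (1 / (m : ℝ)) * ∑ i, ℓ k (S i))| ≤ C + C := by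
    refine abs_ciSup_le fun k => (abs_sub _ _).trans (add_le_add (abs_integral_le (hC k)) ?_)
    simpa [signMean] using abs_signMean_le (1 : Fin m → ℤˣ) hC0 fun i => hC k (S i)
  have hQsplit (σ : Fin m → ℤˣ) : ∫ p, Q σ p ∂(ν.prod ν) ≤
      (∫ S, (⨆ k, signMean σ fun i => ℓ k (S i)) ∂ν) +
        ∫ S, (⨆ k, signMean (-σ) fun i => ℓ k (S i)) ∂ν := by
    calc ∫ p, Q σ p ∂(ν.prod ν)
        ≤ ∫ p : (Fin m → Z) × (Fin m → Z), ((⨆ k, signMean σ fun i => ℓ k (p.2 i)) +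
            ⨆ k, signMean (-σ) fun i => ℓ k (p.1 i)) ∂(ν.prod ν) := by
          refine integral_mono (hQint σ) (((hTint σ).comp_snd ν).add ((hTint (-σ)).comp_fst ν))
            fun p => ciSup_le fun k => ?_
          rw [signMean_sub, sub_eq_add_neg, ← signMean_neg]
          exact add_le_add
            (le_ciSup (f := fun k => signMean σ fun i => ℓ k (p.2 i))
              (bddAbove_range_of_abs_le fun k => abs_signMean_le _ hC0 fun i => hC k _) k)
            (le_ciSup (f := fun k => signMean (-σ) fun i => ℓ k (p.1 i))
              (bddAbove_range_of_abs_le fun k => abs_signMean_le _ hC0 fun i => hC k _) k)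
      _ = _ := by
          rw [integral_add ((hTint σ).comp_snd ν) ((hTint (-σ)).comp_fst ν),
            integral_fun_snd (fun S : Fin m → Z => ⨆ k, signMean σ fun i => ℓ k (S i)),
            integral_fun_fst (fun S : Fin m → Z => ⨆ k, signMean (-σ) fun i => ℓ k (S i))]
          simp
  calc ∫ S, ⨆ k, (∫ z, ℓ k z ∂μ - (1 / (m : ℝ)) * ∑ i, ℓ k (S i)) ∂ν
      ≤ ∫ S, ∫ S', Q 1 (S, S') ∂ν ∂ν :=
        integral_mono (integrable_of_abs_le hgapm hgapb) (hQint 1).integral_prod_left hghost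
    _ = ∫ p, Q 1 p ∂(ν.prod ν) := (integral_prod _ (hQint 1)).symm
    _ = (1 / (2 : ℝ) ^ m) * ∑ σ : Fin m → ℤˣ, ∫ p, Q σ p ∂(ν.prod ν) := by
        simp only [hQ1]
        rw [Finset.sum_const, Finset.card_univ, card_sign, nsmul_eq_mul]
        push_cast
        field_simp
    _ ≤ (1 / (2 : ℝ) ^ m) * ∑ σ : Fin m → ℤˣ,
          ((∫ S, (⨆ k, signMean σ fun i => ℓ k (S i)) ∂ν) +
            ∫ S, (⨆ k, signMean (-σ) fun i => ℓ k (S i)) ∂ν) := by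
        gcongr with σ
        exact hQsplit σ
    _ = 2 * ∫ S, rademacherAverage (fun k i => ℓ k (S i)) ∂ν := by
        rw [Finset.sum_add_distrib,
          sum_sign_neg fun σ => ∫ S, (⨆ k, signMean σ fun i => ℓ k (S i)) ∂ν]
        simp only [rademacherAverage]
        rw [integral_const_mul, integral_finsetSum _ fun σ _ => hTint σ]
        ring

/-- With high probability all averages over the sample are close to the expectations, uniformly
over a countable family of functions with values in `[0, b]`. -/
theorem measure_forall_gap_le [Nonempty ι] (hm : 1 ≤ m) {b δ : ℝ} (hb : 0 ≤ b) (hδ0 : 0 < δ) (hδ1 : δ < 1)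
    (hℓ : ∀ k, Measurable (ℓ k)) (hℓ0 : ∀ k z, 0 ≤ ℓ k z) (hℓb : ∀ k z, ℓ k z ≤ b) :
    ENNReal.ofReal (1 - δ) ≤ (Measure.pi fun _ : Fin m => μ)
      {S | ∀ k, ∫ z, ℓ k z ∂μ - (1 / (m : ℝ)) * ∑ i, ℓ k (S i) ≤
        2 * ∫ S : Fin m → Z, rademacherAverage (fun k i => ℓ k (S i)) ∂(Measure.pi fun _ => μ) +
          b * √(Real.log (2 / δ) / (2 * m))} := by
  set ν : Measure (Fin m → Z) := Measure.pi fun _ => μ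
  have hm' : (0 : ℝ) < m := by exact_mod_cast hm
  have habs (k z) : |ℓ k z| ≤ b := abs_le.2 ⟨by linarith [hℓ0 k z], hℓb k z⟩
  have hR : 0 ≤ ∫ S, rademacherAverage (fun k i => ℓ k (S i)) ∂ν :=
    integral_nonneg fun S => rademacherAverage_nonneg hb fun k i => habs k _
  -- McDiarmid's inequality is applied with a positive difference bound; for `b = 0` all losses
  -- vanish.
  rcases hb.eq_or_lt with rfl | hb0
  · have h0 (k z) : ℓ k z = 0 := le_antisymm (hℓb k z) (hℓ0 k z)
    simp only [h0] at hR
    simp only [h0, zero_mul, integral_zero, Finset.sum_const_zero, mul_zero, sub_zero, add_zero,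
      mul_nonneg zero_le_two hR, implies_true, Set.ofPred_true, measure_univ]
    exact ENNReal.ofReal_le_one.2 (by linarith)
  have hL : 0 < Real.log (2 / δ) := Real.log_pos (by rw [lt_div_iff₀ hδ0]; linarith)
  set f : (Fin m → Z) → ℝ := fun S => ⨆ k, (∫ z, ℓ k z ∂μ - (1 / (m : ℝ)) * ∑ i, ℓ k (S i))
    with hf
  have hS (k : ι) (i : Fin m) : Measurable fun S : Fin m → Z => ℓ k (S i) :=
    (hℓ k).comp (measurable_pi_apply i)
  have hfm : Measurable f :=
    Measurable.iSup fun k => ((Finset.measurable_sum _ fun i _ => hS k i).const_mul _).const_sub _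
  have hgapb (S : Fin m → Z) (k : ι) :
      |∫ z, ℓ k z ∂μ - (1 / (m : ℝ)) * ∑ i, ℓ k (S i)| ≤ b + b := by
    refine (abs_sub _ _).trans (add_le_add (abs_integral_le (habs k)) ?_)
    simpa [signMean] using abs_signMean_le (1 : Fin m → ℤˣ) hb fun i => habs k (S i)
  have hdiff (S : Fin m → Z) (i : Fin m) (z : Z) : |f (Function.update S i z) - f S| ≤ b / m := by
    refine abs_ciSup_sub_ciSup_le (hgapb _) (hgapb _) fun k => ?_
    have hsum : ∑ j, (ℓ k (S j) - ℓ k (Function.update S i z j)) = ℓ k (S i) - ℓ k z := by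
      rw [Finset.sum_eq_single i (fun j _ hj => by simp [hj]) (by simp)]
      simp
    rw [sub_sub_sub_cancel_left, ← mul_sub, ← Finset.sum_sub_distrib, hsum, abs_mul,
      abs_of_pos (one_div_pos.2 hm'), div_mul_eq_mul_div, one_mul]
    gcongr
    exact abs_le.2 ⟨by linarith [hℓ0 k (S i), hℓb k z], by linarith [hℓ0 k z, hℓb k (S i)]⟩
  set ε := b * √(Real.log (2 / δ) / (2 * m)) with hε
  have hmc := measure_boundedDifferences_ge_le μ hm hfm (fun S => abs_ciSup_le (hgapb S))
    (div_pos hb0 hm') hdiff (ε := ε) (by positivity)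
  -- The choice of `ε` makes the failure probability `δ / 2`, which is more than enough.
  have hexp : -2 * ε ^ 2 / (m * (b / m) ^ 2) = -Real.log (2 / δ) := by
    rw [hε, mul_pow, Real.sq_sqrt (by positivity)]
    field_simp
  rw [hexp, ← Real.log_inv, Real.exp_log (by positivity), inv_div] at hmc
  set s : Set (Fin m → Z) := {S | ε ≤ f S - ∫ S', f S' ∂ν}
  have hs : MeasurableSet s := measurableSet_le measurable_const (hfm.sub_const _)
  have hmean : ∫ S', f S' ∂ν ≤ 2 * ∫ S, rademacherAverage (fun k i => ℓ k (S i)) ∂ν :=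
    integral_ciSup_gap_le μ hm hb hℓ habs
  calc ENNReal.ofReal (1 - δ) ≤ ENNReal.ofReal (ν.real sᶜ) := by
        refine ENNReal.ofReal_le_ofReal ?_
        rw [probReal_compl_eq_one_sub hs]
        linarith
    _ = ν sᶜ := by simp
    _ ≤ _ := by
        refine measure_mono fun S hS k => ?_
        have h1 : f S - ∫ S', f S' ∂ν < ε := not_le.1 hS
        have h2 := le_ciSup (bddAbove_range_of_abs_le (hgapb S)) k
        linarith

end Symmetrization

/-! ### From countable families to the generalization gap -/

/-- A signed mean involves finitely many points, so it is continuous under pointwise limits and the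
sequence `g` already attains the supremum in the limit. -/
lemma empiricalRademacher_eq_of_dense {X : Type*} {m : ℕ} {𝓕 : Set (X → ℝ)} {C : ℝ}
    (hC0 : 0 ≤ C) (hC : ∀ f ∈ 𝓕, ∀ x, |f x| ≤ C) {g : ℕ → X → ℝ} (hg : ∀ k, g k ∈ 𝓕)
    (hlim : ∀ f ∈ 𝓕, ∃ k : ℕ → ℕ, ∀ x, Tendsto (fun j => g (k j) x) atTop (𝓝 (f x)))
    (x : Fin m → X) :
    empiricalRademacher 𝓕 x = rademacherAverage fun k i => g k (x i) := by
  have : Nonempty 𝓕 := ⟨⟨g 0, hg 0⟩⟩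
  rw [empiricalRademacher_eq, rademacherAverage, rademacherAverage]
  congr 1
  refine Finset.sum_congr rfl fun σ _ => le_antisymm ?_ ?_
  · refine ciSup_le fun f => ?_
    obtain ⟨k, hk⟩ := hlim f f.2
    have ht : Tendsto (fun j => signMean σ fun i => g (k j) (x i)) atTop
        (𝓝 (signMean σ fun i => (f : X → ℝ) (x i))) :=
      (tendsto_finsetSum _ fun i _ => (hk (x i)).const_mul _).const_mul _
    exact le_of_tendsto' ht fun j => le_ciSup (f := fun k => signMean σ fun i => g k (x i))
      (bddAbove_range_of_abs_le fun k => abs_signMean_le σ hC0 fun i => hC _ (hg k) _) (k j)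
  · refine ciSup_le fun k => ?_
    exact le_ciSup (f := fun f : 𝓕 => signMean σ fun i => (f : X → ℝ) (x i))
      (bddAbove_range_of_abs_le fun f => abs_signMean_le σ hC0 fun i => hC _ f.2 _) ⟨g k, hg k⟩

lemma integrable_empiricalRademacher {X : Type*} [MeasurableSpace X] (μ : Measure (X × ℝ))
    [IsProbabilityMeasure μ] (m : ℕ) {𝓕 : Set (X → ℝ)} (h𝓕 : PointwiseMeasurable 𝓕) {C : ℝ}
    (hC0 : 0 ≤ C) (hC : ∀ f ∈ 𝓕, ∀ x, |f x| ≤ C) :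
    Integrable (fun S : Fin m → X × ℝ => empiricalRademacher 𝓕 fun i => (S i).1)
      (Measure.pi fun _ => μ) := by
  obtain ⟨g, hg, hlim⟩ := h𝓕
  simp only [empiricalRademacher_eq_of_dense hC0 hC (fun k => (hg k).2) hlim]
  exact integrable_of_abs_le
    (measurable_rademacherAverage fun k i => (hg k).1.comp (measurable_pi_apply i).fst)
    fun S => abs_rademacherAverage_le hC0 fun k i => hC _ (hg k).2 _

lemma rademacher_nonneg {X : Type*} [MeasurableSpace X] (μ : Measure (X × ℝ)) (m : ℕ)
    {𝓕 : Set (X → ℝ)} (h𝓕 : 𝓕.Nonempty) {C : ℝ} (hC0 : 0 ≤ C)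
    (hC : ∀ f ∈ 𝓕, ∀ x, |f x| ≤ C) : 0 ≤ rademacher μ m 𝓕 := by
  have := h𝓕.to_subtype
  refine integral_nonneg fun S => ?_
  rw [Pi.zero_apply, empiricalRademacher_eq]
  exact rademacherAverage_nonneg hC0 fun f i => hC _ f.2 _

lemma energy_nonneg {X : Type*} (h : X → ℝ) (x : X) (y : ℝ) : 0 ≤ energy h x y := by
  unfold energy; positivity

lemma energy_le {X : Type*} {h : X → ℝ} {x : X} {y M B : ℝ} (hM : |h x| ≤ M) (hB : |y| ≤ B) :
    energy h x y ≤ (1 / 2) * (M + B) ^ 2 := by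
  unfold energy
  gcongr
  exact (abs_sub _ _).trans (add_le_add hM hB)

/-- The difference of squares factors through the midpoint of the two predictions, which is again at
most `M` in absolute value. -/
lemma abs_energy_sub_energy_le {X : Type*} {h h' : X → ℝ} {x : X} {y M B : ℝ} (hM : |h x| ≤ M)
    (hM' : |h' x| ≤ M) (hB : |y| ≤ B) :
    |energy h x y - energy h' x y| ≤ (M + B) * |h x - h' x| := by
  have e : energy h x y - energy h' x y = (h x / 2 + h' x / 2 - y) * (h x - h' x) := by
    simp only [energy, Real.norm_eq_abs, sq_abs]
    ring
  rw [e, abs_mul]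
  refine mul_le_mul_of_nonneg_right (abs_le.2 ?_) (abs_nonneg _)
  rw [abs_le] at hM hM' hB
  constructor <;> linarith

lemma abs_clamp_le {B : ℝ} (hB : 0 ≤ B) (y : ℝ) : |max (-B) (min y B)| ≤ B :=
  abs_le.2 ⟨le_max_left _ _, max_le (by linarith) (min_le_right _ _)⟩

lemma clamp_eq {B y : ℝ} (h : |y| ≤ B) : max (-B) (min y B) = y := by
  rw [min_eq_left (abs_le.1 h).2, max_eq_right (abs_le.1 h).1]

/-- Uniform generalization bound for a countable class of bounded models whose empirical
Rademacher complexity is at most `c` times that of `𝓕`. -/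
theorem measure_forall_generalizationGap_le {X ι : Type*} [MeasurableSpace X] [Countable ι]
    [Nonempty ι] (μ : Measure (X × ℝ)) [IsProbabilityMeasure μ] {B M c δ : ℝ}
    (hB : ∀ᵐ z ∂μ, |z.2| ≤ B) {m : ℕ} (hm : 1 ≤ m) (hδ0 : 0 < δ) (hδ1 : δ < 1)
    {𝓕 : Set (X → ℝ)} (h𝓕 : Integrable (fun S : Fin m → X × ℝ =>
      empiricalRademacher 𝓕 fun i => (S i).1) (Measure.pi fun _ => μ))
    {H : ι → X → ℝ} (hH : ∀ k, Measurable (H k)) (hM : ∀ k x, |H k x| ≤ M)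
    (hR : ∀ x : Fin m → X, rademacherAverage (fun k i => H k (x i)) ≤
      c * empiricalRademacher 𝓕 x) :
    ENNReal.ofReal (1 - δ) ≤ (Measure.pi fun _ : Fin m => μ)
      {S | ∀ k, generalizationGap μ S (H k) ≤ 2 * (M + B) * c * rademacher μ m 𝓕 +
        (1 / 2) * (M + B) ^ 2 * √(Real.log (2 / δ) / (2 * m))} := by
  obtain ⟨z₀, hz₀⟩ := hB.exists
  have hB0 : 0 ≤ B := (abs_nonneg _).trans hz₀
  obtain ⟨k₀⟩ := ‹Nonempty ι›
  have hM0 : 0 ≤ M := (abs_nonneg _).trans (hM k₀ z₀.1)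
  have : Nonempty ι := ⟨k₀⟩
  -- Labels are bounded only almost surely, while the deviation bound asks for losses bounded
  -- everywhere; clamping the label changes the loss only on a null set.
  let ℓ : ι → X × ℝ → ℝ := fun k z => energy (H k) z.1 (max (-B) (min z.2 B))
  have hℓ (k) : Measurable (ℓ k) := by
    have := hH k
    simp only [ℓ, energy]
    fun_prop
  have hℓb (k z) : ℓ k z ≤ (1 / 2) * (M + B) ^ 2 := energy_le (hM k _) (abs_clamp_le hB0 _)
  have hℓ0 (k z) : 0 ≤ ℓ k z := energy_nonneg _ _ _
  have hℓabs (k z) : |ℓ k z| ≤ (1 / 2) * (M + B) ^ 2 := (abs_of_nonneg (hℓ0 k z)).trans_le (hℓb k z)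
  have hrad : ∫ S : Fin m → X × ℝ, rademacherAverage (fun k i => ℓ k (S i))
      ∂(Measure.pi fun _ => μ) ≤ (M + B) * c * rademacher μ m 𝓕 := by
    rw [rademacher, ← integral_const_mul]
    refine integral_mono (integrable_of_abs_le (C := (1 / 2) * (M + B) ^ 2) ?_ ?_)
      (h𝓕.const_mul _) fun S => ?_
    · exact measurable_rademacherAverage fun k i => (hℓ k).comp (measurable_pi_apply i)
    · exact fun S => abs_rademacherAverage_le (by positivity) fun k i => hℓabs _ _
    · refine (rademacherAverage_contraction (v := fun k i => H k (S i).1) (add_nonneg hM0 hB0)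
        (fun k i => hℓabs _ _) (fun k i => hM _ _) fun k l i =>
          abs_energy_sub_energy_le (hM _ _) (hM _ _) (abs_clamp_le hB0 _)).trans ?_
      rw [mul_assoc]
      exact mul_le_mul_of_nonneg_left (hR _) (add_nonneg hM0 hB0)
  have hS : ∀ᵐ S ∂(Measure.pi fun _ : Fin m => μ), ∀ i, |(S i).2| ≤ B :=
    ae_all_iff.2 fun i => (measurePreserving_eval (fun _ : Fin m => μ) i).quasiMeasurePreserving.ae hB
  have hint (k) : ∫ z, ℓ k z ∂μ = ∫ z, energy (H k) z.1 z.2 ∂μ := by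
    refine integral_congr_ae (hB.mono fun z hz => ?_)
    simp only [ℓ, clamp_eq hz]
  refine (measure_forall_gap_le μ hm (by positivity) hδ0 hδ1 hℓ hℓ0 hℓb).trans
    (measure_mono_ae ?_)
  filter_upwards [hS] with S hS hgap k
  have h := hgap k
  rw [hint k] at h
  simp only [ℓ, clamp_eq (hS _)] at h
  refine h.trans ?_
  have := hrad
  simp only [ℓ] at this
  linarith

/-- Dominated convergence applies because the energies share the bound `(M + B) ^ 2 / 2`. -/
lemma generalizationGap_le_of_tendsto {X : Type*} [MeasurableSpace X] (μ : Measure (X × ℝ))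
    [IsProbabilityMeasure μ] {B M β : ℝ} (hB : ∀ᵐ z ∂μ, |z.2| ≤ B) {m : ℕ} {S : Fin m → X × ℝ}
    {H : ℕ → X → ℝ} (hH : ∀ j, Measurable (H j)) (hM : ∀ j x, |H j x| ≤ M) {h : X → ℝ}
    (hlim : ∀ x, Tendsto (fun j => H j x) atTop (𝓝 (h x)))
    (hgap : ∀ j, generalizationGap μ S (H j) ≤ β) : generalizationGap μ S h ≤ β := by
  have he (x : X) (y : ℝ) : Tendsto (fun j => energy (H j) x y) atTop (𝓝 (energy h x y)) :=
    ((((hlim x).sub_const y).norm).pow 2).const_mul _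
  have hlimgap : Tendsto (fun j => generalizationGap μ S (H j)) atTop
      (𝓝 (generalizationGap μ S h)) := by
    refine Tendsto.sub ?_ ((tendsto_finsetSum _ fun i _ => he _ _).const_mul _)
    refine tendsto_integral_of_dominated_convergence (fun _ => (1 / 2) * (M + B) ^ 2)
      (fun j => ?_) (integrable_const _) (fun j => hB.mono fun z hz => ?_)
      (ae_of_all _ fun z => he _ _)
    · have := hH j
      exact Measurable.aestronglyMeasurable (by simp only [energy]; fun_prop)
    · rw [Real.norm_eq_abs, abs_of_nonneg (energy_nonneg _ _ _)]
      exact energy_le (hM _ _) hz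
  exact le_of_tendsto' hlimgap hgap

/-- Uniform generalization bound for a random class of models, pointwise approximated by a
countable family, that is independent of the sample. -/
theorem probAtLeast_generalizationGap_le {Ω X ι : Type*} [MeasurableSpace Ω] [MeasurableSpace X]
    [Countable ι] [Nonempty ι] (P : Measure Ω) [IsProbabilityMeasure P] (μ : Measure (X × ℝ))
    [IsProbabilityMeasure μ] {B M c δ τ : ℝ} (hB : ∀ᵐ z ∂μ, |z.2| ≤ B) {m : ℕ} (hm : 1 ≤ m)
    (hδ0 : 0 < δ) (hδ1 : δ < 1) {𝓕 : Set (X → ℝ)}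
    (h𝓕 : Integrable (fun S : Fin m → X × ℝ => empiricalRademacher 𝓕 fun i => (S i).1)
      (Measure.pi fun _ => μ))
    {H : ι → Ω → X → ℝ} (hH : ∀ k, Measurable fun q : Ω × X => H k q.1 q.2)
    {𝓗 : Ω → Set (X → ℝ)}
    (hlim : ∀ ω, ∀ h ∈ 𝓗 ω, ∃ k : ℕ → ι, ∀ x, Tendsto (fun j => H (k j) ω x) atTop (𝓝 (h x)))
    (hM : ProbAtLeast P τ {ω | ∀ k x, |H k ω x| ≤ M})
    (hR : ∀ ω, ∀ x : Fin m → X, rademacherAverage (fun k i => H k ω (x i)) ≤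
      c * empiricalRademacher 𝓕 x) :
    ProbAtLeast (P.prod (Measure.pi fun _ : Fin m => μ)) ((1 - δ) * τ)
      {q | ∀ h ∈ 𝓗 q.1, generalizationGap μ q.2 h ≤ 2 * (M + B) * c * rademacher μ m 𝓕 +
        (1 / 2) * (M + B) ^ 2 * √(Real.log (2 / δ) / (2 * m))} := by
  set β := 2 * (M + B) * c * rademacher μ m 𝓕 +
    (1 / 2) * (M + B) ^ 2 * √(Real.log (2 / δ) / (2 * m))
  obtain ⟨t, ht, htM, htτ⟩ := hM
  have hHω (k ω) : Measurable (H k ω) := (hH k).comp measurable_prodMk_left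
  have hgapm (k : ι) : Measurable fun q : Ω × (Fin m → X × ℝ) =>
      generalizationGap μ q.2 (H k q.1) := by
    have hHk := hH k
    have he : Measurable fun q : Ω × (X × ℝ) => energy (H k q.1) q.2.1 q.2.2 := by
      have : Measurable fun q : Ω × (X × ℝ) => H k q.1 q.2.1 :=
        hHk.comp (measurable_fst.prodMk measurable_snd.fst)
      simp only [energy]
      fun_prop
    refine Measurable.sub ?_ ((Finset.measurable_sum _ fun i _ => ?_).const_mul _)
    · exact (StronglyMeasurable.integral_prod_right (ν := μ)
        (f := fun ω z => energy (H k ω) z.1 z.2)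
        he.stronglyMeasurable).measurable.comp measurable_fst
    · exact he.comp (measurable_fst.prodMk ((measurable_pi_apply i).comp measurable_snd))
  -- Only countably many models enter, so this witness is measurable. For each `ω` in `t` its
  -- section has probability at least `1 - δ`.
  let T : Set (Ω × (Fin m → X × ℝ)) :=
    Prod.fst ⁻¹' t ∩ ⋂ k, {q | generalizationGap μ q.2 (H k q.1) ≤ β}
  have hTm : MeasurableSet T := (measurable_fst ht).inter
    (.iInter fun k => measurableSet_le (hgapm k) measurable_const)
  refine ⟨T, hTm, ?_, ?_⟩
  · rintro ⟨ω, S⟩ ⟨hω, hq⟩ h hh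
    obtain ⟨k, hk⟩ := hlim ω h hh
    exact generalizationGap_le_of_tendsto μ hB (fun j => hHω (k j) ω)
      (fun j => htM hω (k j)) hk fun j => Set.mem_iInter.1 hq (k j)
  · rw [Measure.prod_apply hTm, ENNReal.ofReal_mul (by linarith)]
    calc ENNReal.ofReal (1 - δ) * ENNReal.ofReal τ ≤ ENNReal.ofReal (1 - δ) * P t := by gcongr
      _ = ∫⁻ _ω in t, ENNReal.ofReal (1 - δ) ∂P := (setLIntegral_const _ _).symm
      _ ≤ ∫⁻ ω in t, (Measure.pi fun _ => μ) (Prod.mk ω ⁻¹' T) ∂P := by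
          refine setLIntegral_mono_ae' ht (ae_of_all _ fun ω hω => ?_)
          refine (measure_forall_generalizationGap_le μ hB hm hδ0 hδ1 h𝓕 (fun k => hHω k ω)
            (htM hω) (hR ω)).trans (measure_mono fun S hS => ⟨hω, Set.mem_iInter.2 hS⟩)
      _ ≤ ∫⁻ ω, (Measure.pi fun _ => μ) (Prod.mk ω ⁻¹' T) ∂P := setLIntegral_le_lintegral _ _

/-! ### Diversity and the size of a model -/

lemma sq_sum_add_diversity {D : ℕ} (v : EuclideanSpace ℝ (Fin D)) :
    (∑ i, v i) ^ 2 + diversity v = D * ‖v‖ ^ 2 := by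
  have h : ∑ p ∈ (Finset.univ : Finset (Fin D)).offDiag, (v p.1 - v p.2) ^ 2 =
      ∑ i, ∑ j, (v i - v j) ^ 2 := by
    rw [← Finset.sum_product', ← Finset.diag_union_offDiag, Finset.sum_union
      (Finset.disjoint_diag_offDiag _), Finset.sum_diag]
    simp
  rw [diversity, h]
  simp only [EuclideanSpace.real_norm_sq_eq, sub_sq, Finset.sum_add_distrib,
    Finset.sum_sub_distrib, ← Finset.mul_sum, ← Finset.sum_mul, Finset.sum_const, Finset.card_univ,
    Fintype.card_fin, nsmul_eq_mul, mul_assoc]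
  ring

/-- Nonnegativity reduces the bound to `W * ∑ i, Φ x i`, where the diversity identity controls the
sum. -/
lemma abs_innerModel_le {X : Type*} {D : ℕ} {w : Fin D → ℝ} {W A ϑ : ℝ} {Φ : FeatureMap X D}
    {x : X} (hw : ‖w‖ ≤ W) (hpos : ∀ i, 0 ≤ Φ x i) (hA : ‖Φ x‖ ≤ A) (hϑ : IsDiverse ϑ Φ) :
    |innerModel w Φ x| ≤ W * √(D * A ^ 2 - ϑ ^ 2) := by
  have hsum : ∑ i, Φ x i ≤ √(D * A ^ 2 - ϑ ^ 2) := by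
    refine Real.le_sqrt_of_sq_le ?_
    have h1 := sq_sum_add_diversity (Φ x)
    have h2 := hϑ x
    have h3 : (D : ℝ) * ‖Φ x‖ ^ 2 ≤ D * A ^ 2 := by gcongr
    linarith
  calc |innerModel w Φ x| ≤ ∑ i, |w i * Φ x i| := Finset.abs_sum_le_sum_abs _ _
    _ ≤ ∑ i, W * Φ x i := by
        refine Finset.sum_le_sum fun i _ => ?_
        rw [abs_mul, abs_of_nonneg (hpos i)]
        exact mul_le_mul_of_nonneg_right ((norm_le_pi_norm w i).trans hw) (hpos i)
    _ = W * ∑ i, Φ x i := (Finset.mul_sum _ _ _).symm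
    _ ≤ W * √(D * A ^ 2 - ϑ ^ 2) :=
        mul_le_mul_of_nonneg_left hsum ((norm_nonneg _).trans hw)

lemma measurable_innerModel {Ω X : Type*} [MeasurableSpace Ω] [MeasurableSpace X] {D : ℕ}
    (w : Fin D → ℝ) {Φ : Ω → FeatureMap X D} (hΦ : Measurable fun q : Ω × X => Φ q.1 q.2) :
    Measurable fun q : Ω × X => innerModel w (Φ q.1) q.2 :=
  Finset.measurable_sum _ fun i _ =>
    (((EuclideanSpace.proj (𝕜 := ℝ) i).continuous.measurable).comp hΦ).const_mul _

lemma tendsto_innerModel {X : Type*} {D : ℕ} {w : ℕ → Fin D → ℝ} {w' : Fin D → ℝ}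
    {Φ : ℕ → FeatureMap X D} {Φ' : FeatureMap X D} {x : X} (hw : Tendsto w atTop (𝓝 w'))
    (hΦ : Tendsto (fun j => Φ j x) atTop (𝓝 (Φ' x))) :
    Tendsto (fun j => innerModel (w j) (Φ j) x) atTop (𝓝 (innerModel w' Φ' x)) :=
  tendsto_finsetSum _ fun i _ => (tendsto_pi_nhds.1 hw i).mul
    (((EuclideanSpace.proj (𝕜 := ℝ) i).continuous.tendsto _).comp hΦ)

/-- The bound is strictly decreasing in the diversity. -/
theorem strictAntiOn_regressionBound {D m : ℕ} (hm : 1 ≤ m) {A B δ W R : ℝ} (hB : 0 ≤ B)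
    (hδ0 : 0 < δ) (hδ1 : δ < 1) (hR : 0 ≤ R) (hW : 0 < W) :
    StrictAntiOn (regressionBound D m A B δ W R) (Set.Icc 0 (√D * A)) := by
  intro a ha b hb hab
  have hm' : (0 : ℝ) < m := by exact_mod_cast hm
  have hL : 0 < Real.log (2 / δ) := Real.log_pos (by rw [lt_div_iff₀ hδ0]; linarith)
  have hs : 0 < √(Real.log (2 / δ) / (2 * m)) := Real.sqrt_pos.2 (by positivity)
  -- This keeps the radicand nonnegative; beyond this range `√` is constantly zero and strictness
  -- would fail.
  have hb2 : b ^ 2 ≤ D * A ^ 2 := by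
    have := pow_le_pow_left₀ hb.1 hb.2 2
    rwa [mul_pow, Real.sq_sqrt (Nat.cast_nonneg D)] at this
  have hab2 : a ^ 2 < b ^ 2 := pow_lt_pow_left₀ hab ha.1 two_ne_zero
  have hr : √(D * A ^ 2 - b ^ 2) < √(D * A ^ 2 - a ^ 2) :=
    Real.sqrt_lt_sqrt (by linarith) (by linarith)
  have hr0 := Real.sqrt_nonneg (D * A ^ 2 - b ^ 2)
  unfold regressionBound
  -- Strictness comes from the confidence term, since the complexity `R` may vanish.
  refine add_lt_add_of_le_of_lt ?_ ?_
  · gcongr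
  · gcongr

lemma ProbAtLeast.mono {Ω : Type*} [MeasurableSpace Ω] {P : Measure Ω} {p : ℝ} {s s' : Set Ω}
    (h : ProbAtLeast P p s) (hs : s ⊆ s') : ProbAtLeast P p s' :=
  let ⟨t, ht, hts, hp⟩ := h
  ⟨t, ht, hts.trans hs, hp⟩

/-- The approximating weights must stay in the ball themselves, so that each approximating model
obeys the bound with the same `W`. -/
lemma exists_seq_dense_ball {E : Type*} [NormedAddCommGroup E]
    [TopologicalSpace.SeparableSpace E] {W : ℝ} (hW : 0 ≤ W) :
    ∃ v : ℕ → E, (∀ n, ‖v n‖ ≤ W) ∧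
      ∀ w, ‖w‖ ≤ W → ∃ l : ℕ → ℕ, Tendsto (fun j => v (l j)) atTop (𝓝 w) := by
  have : Nonempty {w : E // ‖w‖ ≤ W} := ⟨⟨0, by simpa using hW⟩⟩
  have : TopologicalSpace.SeparableSpace {w : E // ‖w‖ ≤ W} :=
    (TopologicalSpace.IsSeparable.of_separableSpace {w : E | ‖w‖ ≤ W}).separableSpace
  refine ⟨fun n => TopologicalSpace.denseSeq {w : E // ‖w‖ ≤ W} n, 
      fun n => (TopologicalSpace.denseSeq {w : E // ‖w‖ ≤ W} n).2,
    fun w hw => ?_⟩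
  obtain ⟨u, hu, hulim⟩ := mem_closure_iff_seq_limit.1
    (TopologicalSpace.denseRange_denseSeq {w : E // ‖w‖ ≤ W} ⟨w, hw⟩)
  choose l hl using hu
  refine ⟨l, ?_⟩
  simp only [hl]
  exact (continuous_subtype_val.tendsto _).comp hulim

end EBM

end

/-! ### The generalization theorem -/

open EBM in
/-- Generalization bound for regression with squared energy and diverse features. The features are
drawn according to `P`, independently of the sample. The norm of `w : Fin D → ℝ` is the sup norm. -/
theorem theorem1
    {X : Type*} [MeasurableSpace X] {Ω : Type*} [MeasurableSpace Ω]
    (P : Measure Ω) [IsProbabilityMeasure P]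
    (μ : Measure (X × ℝ)) [IsProbabilityMeasure μ]
    (𝒴 : Set ℝ) (B : ℝ) (hB : ∀ y ∈ 𝒴, |y| ≤ B) (hμ : ∀ᵐ z ∂μ, z.2 ∈ 𝒴)
    (D m : ℕ) (hm : 1 ≤ m) (A ϑ τ δ : ℝ) (hδ0 : 0 < δ) (hδ1 : δ < 1)
    (𝓕 : Set (X → ℝ)) (h𝓕 : PointwiseMeasurable 𝓕) (hbdd : ∃ C : ℝ, ∀ f ∈ 𝓕, ∀ x, |f x| ≤ C)
    (𝒢 : Ω → Set (FeatureMap X D)) (h𝒢 : RandomPointwiseMeasurable 𝒢)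
    (hmem : ∀ ω, ∀ Φ ∈ 𝒢 ω, ∀ i, (fun x => Φ x i) ∈ 𝓕)
    (hpos : ∀ ω, ∀ Φ ∈ 𝒢 ω, ∀ x i, 0 ≤ Φ x i)
    (hA : ∀ ω, ∀ Φ ∈ 𝒢 ω, ∀ x, ‖Φ x‖ ≤ A)
    (hdiv : ProbAtLeast P τ {ω | ∀ Φ ∈ 𝒢 ω, IsDiverse ϑ Φ}) :
    -- the class of all models with a given weight vector
    (∀ w : Fin D → ℝ,
      ProbAtLeast (P.prod (Measure.pi fun _ : Fin m => μ)) ((1 - δ) * τ)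
        {q | ∀ h ∈ hypothesisClass {w} (𝒢 q.1),
          generalizationGap μ q.2 h ≤ regressionBound D m A B δ ‖w‖ (rademacher μ m 𝓕) ϑ}) ∧
    -- the class of all models with weights of sup norm at most `W`
    (0 ∈ 𝓕 → ∀ W : ℝ, 0 ≤ W →
      ProbAtLeast (P.prod (Measure.pi fun _ : Fin m => μ)) ((1 - δ) * τ)
        {q | ∀ h ∈ hypothesisClass {w : Fin D → ℝ | ‖w‖ ≤ W} (𝒢 q.1),
          generalizationGap μ q.2 h ≤ regressionBound D m A B δ W (rademacher μ m 𝓕) ϑ}) ∧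
    -- the bound decreases as the diversity grows
    (∀ W : ℝ, 0 < W →
      StrictAntiOn (regressionBound D m A B δ W (rademacher μ m 𝓕)) (Set.Icc 0 (√D * A))) := by
  have hBae : ∀ᵐ z ∂μ, |z.2| ≤ B := hμ.mono fun z hz => hB _ hz
  obtain ⟨z₀, hz₀⟩ := hBae.exists
  have hB0 : 0 ≤ B := (abs_nonneg _).trans hz₀
  obtain ⟨C, hC⟩ := hbdd
  have hne : 𝓕.Nonempty := ⟨_, (h𝓕.choose_spec.1 0).2⟩
  have hC0 : 0 ≤ C := (abs_nonneg _).trans (hC _ hne.some_mem z₀.1)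
  have hint := integrable_empiricalRademacher μ m h𝓕 hC0 hC
  have hR0 := rademacher_nonneg μ m hne hC0 hC
  have : Nonempty 𝓕 := hne.to_subtype
  obtain ⟨Ψ, hΨ, hΨlim⟩ := h𝒢
  have hbound {W : ℝ} {w : Fin D → ℝ} (hw : ‖w‖ ≤ W) (k : ℕ) {ω : Ω}
      (hω : ∀ Φ ∈ 𝒢 ω, IsDiverse ϑ Φ) (x : X) :
      |innerModel w (Ψ k ω) x| ≤ W * √(D * A ^ 2 - ϑ ^ 2) :=
    have hk := (hΨ k).2 ω
    abs_innerModel_le hw (hpos ω _ hk x) (hA ω _ hk x) (hω _ hk)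
  refine ⟨fun w => ?_, fun h0 W hW => ?_, fun W hW =>
    strictAntiOn_regressionBound hm hB0 hδ0 hδ1 hR0 hW⟩
  · have key := probAtLeast_generalizationGap_le P μ (ι := ℕ) (τ := τ)
      (M := ‖w‖ * √(D * A ^ 2 - ϑ ^ 2)) (c := D * ‖w‖) hBae hm hδ0 hδ1 hint
      (H := fun k ω => innerModel w (Ψ k ω)) (fun k => measurable_innerModel w (hΨ k).1)
      (𝓗 := fun ω => hypothesisClass {w} (𝒢 ω)) ?_ ?_ ?_
    · refine key.mono fun q hq h hh => (hq h hh).trans ?_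
      -- For a fixed `w` the argument gives the constant `2` in the complexity term; the stated `4`
      -- leaves a nonnegative surplus.
      have : 0 ≤ D * ‖w‖ * (‖w‖ * √(D * A ^ 2 - ϑ ^ 2) + B) * rademacher μ m 𝓕 := by positivity
      unfold regressionBound
      linarith
    · rintro ω h ⟨w, rfl, Φ, hΦ, rfl⟩
      obtain ⟨k, hk⟩ := hΨlim ω Φ hΦ
      exact ⟨k, fun x => tendsto_innerModel (Φ := fun j => Ψ (k j) ω) tendsto_const_nhds (hk x)⟩
    · exact hdiv.mono fun ω hω k x => hbound le_rfl k hω x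
    · intro ω x
      let φ : ℕ → Fin D → 𝓕 := fun k j => ⟨_, hmem ω _ ((hΨ k).2 ω) j⟩
      exact rademacherAverage_linear_le (u := fun (f : 𝓕) i => (f : X → ℝ) (x i)) hC0
        (fun f i => hC _ f.2 _) w φ
  · obtain ⟨v, hv, hvlim⟩ := exists_seq_dense_ball (E := Fin D → ℝ) hW
    -- Pairs approximate weights and features simultaneously; `c = 2 * D * W` yields exactly the
    -- constant `4`.
    have key := probAtLeast_generalizationGap_le P μ (ι := ℕ × ℕ) (τ := τ)
      (M := W * √(D * A ^ 2 - ϑ ^ 2)) (c := 2 * D * W) hBae hm hδ0 hδ1 hint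
      (H := fun k ω => innerModel (v k.1) (Ψ k.2 ω))
      (fun k => measurable_innerModel _ (hΨ k.2).1)
      (𝓗 := fun ω => hypothesisClass {w : Fin D → ℝ | ‖w‖ ≤ W} (𝒢 ω)) ?_ ?_ ?_
    · refine key.mono fun q hq h hh => (hq h hh).trans (le_of_eq ?_)
      unfold regressionBound
      ring
    · rintro ω h ⟨w, hw, Φ, hΦ, rfl⟩
      obtain ⟨k, hk⟩ := hΨlim ω Φ hΦ
      obtain ⟨l, hl⟩ := hvlim w hw
      exact ⟨fun j => (l j, k j), fun x =>
        tendsto_innerModel (Φ := fun j => Ψ (k j) ω) hl (hk x)⟩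
    · exact hdiv.mono fun ω hω k x => hbound (hv k.1) k.2 hω x
    · intro ω x
      let φ : ℕ × ℕ → Fin D → 𝓕 := fun k j => ⟨_, hmem ω _ ((hΨ k.2).2 ω) j⟩
      exact rademacherAverage_linear_ball_le (u := fun (f : 𝓕) i => (f : X → ℝ) (x i)) hC0
        (fun f i => hC _ f.2 _) ⟨0, h0⟩ (fun i => rfl) (fun k : ℕ × ℕ => v k.1)
        (fun k => hv k.1) φ
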